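/- Let $p$ be a prime and $r \ge 1$. Let $\mathcal{F}$ be a pro-$p$ group topologically generated by elements $y$ and $x_1, \dots, x_r$. For each $1 \le i \le r$ let $(a_{i,j})_{j \ge 1}$ be a sequence of $p$-adic integers, and define $x_{i,1} = x_i$ and \[ x_{i,j+1} = [y, x_{i,j}]\, x_{i,j}^{p a_{i,j}} = y x_{i,j} y^{-1} x_{i,j}^{-1 + p a_{i,j}} \qquad (j \ge 1), \] where $[g,h] = g h g^{-1} h^{-1}$ and, for $g \in \mathcal{F}$ and $a \in \mathbf{Z}_p$, $g^a$ is the limit of the powers $g^{n_k}$ for any natural numbers $n_k \to a$ in $\mathbf{Z}_p$. Let $H$ be the smallest closed normal subgroup of $\mathcal{F}$ containing $x_1, \dots, x_r$. A pro-$p$ group $G$ is called free pro-$p$ on a family $(g_k)_{k \in I}$ of its elements if the family converges to $1$ (every neighbourhood of $1$ contains $g_k$ for all but finitely many $k \in I$) and, for every pro-$p$ group $P$ and every family $(h_k)_{k \in I}$ in $P$ converging to $1$, there is a unique continuous homomorphism $G \to P$ with $g_k \mapsto h_k$ for all $k \in I$. Then: (a) The elements $x_{i,j}$ with $1 \le i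 \le r$ and $j \ge 1$ topologically generate $H$. (b) If $\mathcal{F}$ is a free pro-$p$ group on the elements $y, x_1, \dots, x_r$, then $H$ is a free pro-$p$ group on the elements $x_{i,j}$ with $1 \le i \le r$ and $j \ge 1$. (c) If $H$ is a free pro-$p$ group on the elements $x_{i,j}$ with $1 \le i \le r$ and $j \ge 1$, and $y^{p^n} \notin H$ for all integers $n \ge 0$, then $\mathcal{F}$ is a free pro-$p$ group on the elements $y, x_1, \dots, x_r$. -/

import Mathlib

open Filter Topology
open scoped commutatorElement

universe u v

/-- `G` is a pro-`p` group: a compact, Hausdorff, totally disconnected topological group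
in which every open normal subgroup has index a power of `p`. -/
structure IsProP (p : ℕ) (G : Type u) [Group G] [TopologicalSpace G] : Prop where
  isTopologicalGroup : IsTopologicalGroup G
  compactSpace : CompactSpace G
  t2Space : T2Space G
  totallyDisconnectedSpace : TotallyDisconnectedSpace G
  index_eq_pow : ∀ U : Subgroup G, U.Normal → IsOpen (U : Set G) → ∃ k : ℕ, U.index = p ^ k

/-- `G` is a free pro-`p` group on the family `x` (a basis converging to `1`):
`G` is pro-`p`, the family converges to `1` (every neighbourhood of `1` contains all but finitely
many of its members), and every family, with the same index set, of elements of a pro-`p` group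
that converges to `1` is the image of `x` under exactly one continuous homomorphism. For a finite
index set the two convergence conditions are void. -/
structure IsFreeProP (p : ℕ) {G : Type u} [Group G] [TopologicalSpace G] {ι : Type v}
    (x : ι → G) : Prop where
  isProP : IsProP p G
  tendsto_one : Tendsto x cofinite (𝓝 1)
  existsUnique_lift : ∀ (P : Type u) [Group P] [TopologicalSpace P], IsProP p P →
    ∀ f : ι → P, Tendsto f cofinite (𝓝 1) → ∃! φ : G →ₜ* P, ∀ i, φ (x i) = f i

/-- The power `g ^ a` of an element of a pro-`p` group with exponent a `p`-adic integer `a`: the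
limit of the powers `g ^ aₙ`, where `aₙ` is the natural number below `p ^ n` congruent to `a`
modulo `p ^ n`. The limit exists in every pro-`p` group, by `tendsto_padicPow`. -/
noncomputable def padicPow (p : ℕ) [Fact p.Prime] {G : Type u} [Group G] [TopologicalSpace G]
    (g : G) (a : ℤ_[p]) : G :=
  haveI : Nonempty G := ⟨1⟩
  limUnder atTop fun n : ℕ => g ^ a.appr n

theorem tendsto_padicPow {p : ℕ} [Fact p.Prime] {G : Type u} [Group G] [TopologicalSpace G]
    (hG : IsProP p G) (g : G) (a : ℤ_[p]) :
    Tendsto (fun n : ℕ => g ^ a.appr n) atTop (𝓝 (padicPow p g a)) := by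
  have := hG.isTopologicalGroup
  have := hG.compactSpace
  have := hG.t2Space
  have := hG.totallyDisconnectedSpace
  have : Nonempty G := ⟨1⟩
  refine tendsto_nhds_limUnder ?_
  obtain ⟨b, hb⟩ := exists_clusterPt_of_compactSpace
    (map (fun n : ℕ => g ^ a.appr n) atTop)
  have hb' : MapClusterPt b atTop (fun n : ℕ => g ^ a.appr n) := hb
  refine ⟨b, ?_⟩
  rw [tendsto_nhds]
  intro V hV hbV
  have hW : IsOpen ((fun x => b * x) ⁻¹' V) := hV.preimage (by fun_prop)
  obtain ⟨U, hU⟩ := ProfiniteGrp.exist_openNormalSubgroup_sub_open_nhds_of_one hW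
    (by simpa using hbV)
  obtain ⟨k, hk⟩ := hG.index_eq_pow U.toSubgroup inferInstance U.isOpen'
  have hg : g ^ p ^ k ∈ U.toSubgroup := hk ▸ Subgroup.pow_index_mem U.toSubgroup g
  have key : ∀ n, k ≤ n → (g ^ a.appr k)⁻¹ * g ^ a.appr n ∈ U.toSubgroup := by
    intro n hn
    obtain ⟨c, hc⟩ := PadicInt.dvd_appr_sub_appr a k n hn
    have : a.appr n = a.appr k + p ^ k * c := by
      have := PadicInt.appr_mono a hn
      omega
    rw [this, pow_add, inv_mul_cancel_left, pow_mul]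
    exact Subgroup.pow_mem _ hg c
  have hN : (fun x => b⁻¹ * x) ⁻¹' (U : Set G) ∈ 𝓝 b :=
    (U.isOpen'.preimage (by fun_prop)).mem_nhds (by
      change b⁻¹ * b ∈ U.toSubgroup
      simp)
  obtain ⟨m, hm, hmU⟩ := ((mapClusterPt_iff_frequently.1 hb') _ hN).forall_exists_of_atTop k
  filter_upwards [eventually_ge_atTop k] with n hn
  have h1 : b⁻¹ * g ^ a.appr m ∈ U.toSubgroup := hmU
  have h2 := U.toSubgroup.mul_mem (U.toSubgroup.mul_mem h1
    (U.toSubgroup.inv_mem (key m hm))) (key n hn)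
  have h3 : b⁻¹ * g ^ a.appr n ∈ U.toSubgroup := by
    convert h2 using 1
    group
  simpa using hU h3

/-- The sequence `x, [y, x] x ^ (p a₀), …`: its first term is `x`, and each term `s` is followed by
`[y, s] s ^ (p a) = y s y⁻¹ s⁻¹ s ^ (p a)`. The terms are indexed from `0` on. -/
noncomputable def commSeq (p : ℕ) [Fact p.Prime] {G : Type u} [Group G] [TopologicalSpace G]
    (y x : G) (a : ℕ → ℤ_[p]) : ℕ → G
  | 0 => x
  | j + 1 => ⁅y, commSeq p y x a j⁆ * padicPow p (commSeq p y x a j) (p * a j)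

/-- The closed normal subgroup of `G` generated by the members of the family `x`. -/
def closedNormalClosure {G : Type u} [Group G] [TopologicalSpace G]
    [IsTopologicalGroup G] {ι : Type v} (x : ι → G) : Subgroup G :=
  (Subgroup.normalClosure (Set.range x)).topologicalClosure

theorem commSeq_mem {p : ℕ} [Fact p.Prime] {G : Type u} [Group G] [TopologicalSpace G]
    [IsTopologicalGroup G] (hG : IsProP p G) {ι : Type v} (y : G) (x : ι → G) (a : ι → ℕ → ℤ_[p]) (i : ι) (j : ℕ) :
    commSeq p y (x i) (a i) j ∈ closedNormalClosure x := by
  have hn : (closedNormalClosure x).Normal :=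
    Subgroup.is_normal_topologicalClosure _
  have hc : IsClosed (closedNormalClosure x : Set G) :=
    Subgroup.isClosed_topologicalClosure _
  induction j with
  | zero =>
    exact Subgroup.le_topologicalClosure _ (Subgroup.subset_normalClosure ⟨i, rfl⟩)
  | succ j ih =>
    refine Subgroup.mul_mem _ ?_ ?_
    · rw [commutatorElement_def]
      exact Subgroup.mul_mem _ (hn.conj_mem _ ih y) (Subgroup.inv_mem _ ih)
    · exact hc.mem_of_tendsto (tendsto_padicPow hG _ _)
        (Eventually.of_forall fun n => Subgroup.pow_mem _ ih _)

/-- The members of the sequences `commSeq p y (x i) (a i)`, as a family of elements of the closed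
normal subgroup generated by the `x i`. -/
noncomputable def commFamily {p : ℕ} [Fact p.Prime] {G : Type u} [Group G] [TopologicalSpace G]
    [IsTopologicalGroup G] (hG : IsProP p G) {ι : Type v} (y : G) (x : ι → G) (a : ι → ℕ → ℤ_[p]) (ij : ι × ℕ) :
    closedNormalClosure x :=
  ⟨commSeq p y (x ij.1) (a ij.1) ij.2, commSeq_mem hG y x a ij.1 ij.2⟩

/-! Write `H` for the closed normal subgroup. The recursion, solved for the conjugate, reads `y s_j
y⁻¹ = s_{j+1} s_j ^ (1 - p a_j)`. So conjugation by `y` preserves the closed subgroup generated by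
all the `s_j`, which is therefore normal; this gives (a).

For freeness it is enough to lift to finite `p`-groups `P` (`IsFreeProP.of_finite_lift`): the closed
subgroup generated by the pairs (generator, image) is then the graph of the required map.

For (b), prescribe finitely many nontrivial values in `P`. On arrays `u` in `P` the recursion
defines a map `T`, and the coordinate functions satisfy `e_j ∘ T = e_{j+1} e_j ^ q_j` with `q_j ≡ 1`
mod `p`. The crux is that `T` is a permutation of `p`-power order
(`exists_iterate_triangularMap_eq`), so that a wreath-type product `P ^ Ω ⋊ ⟨T⟩` is a finite
`p`-group. Freeness of `F` maps it there with `s_j ↦ e_j`, and evaluation at the prescribed array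
gives the lift on `H`.

For (c), freeness of `H` gives a map to `P` that sends each `s_j` to the same recursion in `P`. It
intertwines conjugation by `y` and by `Y`, and extends to `F` because `y` has order divisible by
arbitrarily high powers of `p` in finite quotients of `F ⧸ H` (`exists_lift_of_equivariant`). -/

section PadicPow

/-! ### Powers with `p`-adic exponents -/

variable {p : ℕ} [Fact p.Prime]

theorem map_padicPow {G : Type*} [Group G] [TopologicalSpace G] (hG : IsProP p G)
    {P : Type*} [Group P] [TopologicalSpace P] (hP : IsProP p P)
    (φ : G →* P) (hφ : Continuous φ) (g : G) (a : ℤ_[p]) :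
    φ (padicPow p g a) = padicPow p (φ g) a := by
  have := hP.t2Space
  refine tendsto_nhds_unique ((hφ.tendsto _).comp (tendsto_padicPow hG g a)) ?_
  simpa [Function.comp_def] using tendsto_padicPow hP (φ g) a

theorem padicPow_eq_pow_appr {G : Type*} [Group G] [TopologicalSpace G] (hG : IsProP p G)
    {g : G} {k : ℕ} (hg : g ^ p ^ k = 1) (a : ℤ_[p]) :
    padicPow p g a = g ^ a.appr k := by
  have := hG.t2Space
  refine tendsto_nhds_unique (tendsto_padicPow hG g a) (tendsto_const_nhds.congr' ?_)
  filter_upwards [eventually_ge_atTop k] with n hn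
  obtain ⟨c, hc⟩ := PadicInt.dvd_appr_sub_appr a k n hn
  have : a.appr n = a.appr k + p ^ k * c := by
    have := PadicInt.appr_mono a hn
    omega
  rw [this, pow_add, pow_mul, hg, one_pow, mul_one]

theorem dvd_appr_mul (a : ℤ_[p]) (k : ℕ) : p ∣ ((p : ℤ_[p]) * a).appr k := by
  rcases k with _ | k
  · simp [PadicInt.appr]
  have h := PadicInt.appr_spec (k + 1) ((p : ℤ_[p]) * a)
  rw [Ideal.mem_span_singleton] at h
  have h1 : (p : ℤ_[p]) ∣ ((p * a : ℤ_[p]).appr (k + 1) : ℤ_[p]) := by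
    have h2 : (p : ℤ_[p]) ∣ p * a - ((p * a : ℤ_[p]).appr (k + 1) : ℤ_[p]) :=
      (dvd_pow_self _ k.succ_ne_zero).trans h
    simpa using (dvd_sub (dvd_mul_right (p : ℤ_[p]) a) h2)
  have h3 := (PadicInt.norm_le_pow_iff_mem_span_pow (p := p)
    (((p * a : ℤ_[p]).appr (k + 1) : ℕ) : ℤ_[p]) 1).2
    (by rwa [pow_one, Ideal.mem_span_singleton])
  have h4 := (PadicInt.norm_int_le_pow_iff_dvd (p := p) (k := ((p * a : ℤ_[p]).appr (k + 1) : ℤ))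
    (n := 1)).1 (by simpa using h3)
  rw [pow_one] at h4
  exact_mod_cast h4

end PadicPow

/-! ### Quotients and closed subgroups of pro-`p` groups -/

theorem IsProP.of_finite {p : ℕ} [Fact p.Prime] {P : Type*} [Group P] [TopologicalSpace P]
    [DiscreteTopology P] [Finite P] (hP : IsPGroup p P) : IsProP p P where
  isTopologicalGroup := inferInstance
  compactSpace := inferInstance
  t2Space := inferInstance
  totallyDisconnectedSpace := inferInstance
  index_eq_pow U _ _ := hP.index U

theorem IsProP.exists_openNormal_le {p : ℕ} {G : Type*} [Group G] [TopologicalSpace G]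
    (hG : IsProP p G) {V : Set G} (hV : V ∈ 𝓝 (1 : G)) :
    ∃ U : Subgroup G, U.Normal ∧ IsOpen (U : Set G) ∧ (U : Set G) ⊆ V := by
  have := hG.isTopologicalGroup
  have := hG.compactSpace
  have := hG.totallyDisconnectedSpace
  obtain ⟨W, hWV, hW, h1⟩ := mem_nhds_iff.1 hV
  obtain ⟨U, hU⟩ := ProfiniteGrp.exist_openNormalSubgroup_sub_open_nhds_of_one hW h1
  exact ⟨U.toSubgroup, inferInstance, U.isOpen', hU.trans hWV⟩

theorem IsProP.isPGroup_quotient {p : ℕ} {G : Type*} [Group G] [TopologicalSpace G]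
    (hG : IsProP p G) (U : Subgroup G) [hn : U.Normal] (hU : IsOpen (U : Set G)) :
    IsPGroup p (G ⧸ U) := by
  obtain ⟨k, hk⟩ := hG.index_eq_pow U hn hU
  exact IsPGroup.of_card (n := k) (by rw [← hk, Subgroup.index])

theorem IsProP.finite_quotient {p : ℕ} {G : Type*} [Group G] [TopologicalSpace G]
    (hG : IsProP p G) (U : Subgroup G) (hU : IsOpen (U : Set G)) : Finite (G ⧸ U) := by
  have := hG.isTopologicalGroup
  have := hG.compactSpace
  exact Subgroup.quotient_finite_of_isOpen U hU

theorem IsProP.subgroup {p : ℕ} [Fact p.Prime] {G : Type*} [Group G] [TopologicalSpace G]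
    (hG : IsProP p G) (H : Subgroup G) (hH : IsClosed (H : Set G)) : IsProP p H where
  isTopologicalGroup := by
    have := hG.isTopologicalGroup
    infer_instance
  compactSpace := by
    have := hG.compactSpace
    exact isCompact_iff_compactSpace.1 hH.isCompact
  t2Space := by
    have := hG.t2Space
    infer_instance
  totallyDisconnectedSpace := by
    have := hG.totallyDisconnectedSpace
    infer_instance
  index_eq_pow V hV hVo := by
    have := hG.isTopologicalGroup
    have h1 : (V : Set H) ∈ 𝓝 (1 : H) := hVo.mem_nhds V.one_mem
    rw [nhds_subtype_eq_comap, mem_comap] at h1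
    obtain ⟨S, hS, hSV⟩ := h1
    obtain ⟨U, hUn, hUo, hUS⟩ := hG.exists_openNormal_le (V := S) (by simpa using hS)
    -- `V` contains the trace on `H` of an open normal subgroup `U` of `G`, so its index divides
    -- that of `U`.
    have hle : U.subgroupOf H ≤ V := fun h hh => hSV (hUS hh)
    have hfin := hG.finite_quotient U hUo
    obtain ⟨k, hk⟩ := hG.index_eq_pow U hUn hUo
    have h2 : V.index ∣ p ^ k := by
      rw [← hk]
      refine (Subgroup.index_dvd_of_le hle).trans ?_
      exact Subgroup.relIndex_dvd_index_of_normal U H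
    obtain ⟨m, -, hm⟩ := (Nat.dvd_prime_pow Fact.out).1 h2
    exact ⟨m, hm⟩

/-! ### Constructing homomorphisms from graphs and from finite tests -/

theorem eq_of_eqOn_topologicalGenerators {G P ι : Type*} [Group G] [TopologicalSpace G]
    [IsTopologicalGroup G]
    [Group P] [TopologicalSpace P] [T2Space P] {x : ι → G}
    (hx : (Subgroup.closure (Set.range x)).topologicalClosure = ⊤) {φ ψ : G →* P}
    (hφ : Continuous φ) (hψ : Continuous ψ) (h : ∀ i, φ (x i) = ψ (x i)) : φ = ψ := by
  have : (Subgroup.closure (Set.range x)).topologicalClosure ≤ φ.eqLocus ψ := by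
    refine Subgroup.topologicalClosure_minimal _ ?_ (isClosed_eq hφ hψ)
    rw [Subgroup.closure_le]
    rintro _ ⟨i, rfl⟩
    exact h i
  ext g
  exact this (hx ▸ Subgroup.mem_top g)

/-- A closed subgroup of `G × P` which meets `{1} × P` trivially and projects onto a topologically
generating set of `G` is the graph of a continuous homomorphism. -/
theorem exists_lift_of_graph {G P ι : Type*} [Group G] [TopologicalSpace G]
    [IsTopologicalGroup G] [CompactSpace G] [T2Space G]
    [Group P] [TopologicalSpace P] [IsTopologicalGroup P] [CompactSpace P] [T2Space P]
    {x : ι → G} (hx : (Subgroup.closure (Set.range x)).topologicalClosure = ⊤)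
    (Γ : Subgroup (G × P)) (hΓ : IsClosed (Γ : Set (G × P))) (f : ι → P)
    (hf : ∀ i, (x i, f i) ∈ Γ) (h1 : ∀ b, ((1 : G), b) ∈ Γ → b = 1) :
    ∃ φ : G →ₜ* P, ∀ i, φ (x i) = f i := by
  have : CompactSpace Γ := isCompact_iff_compactSpace.1 hΓ.isCompact
  let π : Γ →* G := (MonoidHom.fst G P).comp Γ.subtype
  have hπ : Continuous π := continuous_fst.comp continuous_subtype_val
  have hinj : Function.Injective π := by
    rw [injective_iff_map_eq_one]
    rintro ⟨⟨g, b⟩, hgb⟩ (rfl : g = 1)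
    obtain rfl := h1 b hgb
    rfl
  have hsurj : Function.Surjective π := by
    rw [← MonoidHom.range_eq_top, eq_top_iff, ← hx]
    refine Subgroup.topologicalClosure_minimal _ ?_ (isCompact_range hπ).isClosed
    rw [Subgroup.closure_le]
    rintro _ ⟨i, rfl⟩
    exact ⟨⟨_, hf i⟩, rfl⟩
  let e : Γ ≃* G := MulEquiv.ofBijective π ⟨hinj, hsurj⟩
  have he : Continuous e.symm := by
    have : Continuous e.toEquiv := hπ
    exact (Continuous.homeoOfEquivCompactToT2 this).continuous_invFun
  refine ⟨⟨((MonoidHom.snd G P).comp Γ.subtype).comp e.symm.toMonoidHom,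
    (continuous_snd.comp continuous_subtype_val).comp he⟩, fun i => ?_⟩
  have : e.symm (x i) = ⟨_, hf i⟩ := e.symm_apply_eq.2 rfl
  change (e.symm (x i)).1.2 = f i
  rw [this]

/-- Freeness of a topologically generating family may be tested on finite `p`-groups. -/
theorem IsFreeProP.of_finite_lift {p : ℕ} [Fact p.Prime] {G : Type u} [Group G]
    [TopologicalSpace G] (hG : IsProP p G) {ι : Type v} {x : ι → G}
    [IsTopologicalGroup G] (hx : (Subgroup.closure (Set.range x)).topologicalClosure = ⊤)
    (hx1 : Tendsto x cofinite (𝓝 1))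
    (H : ∀ (P : Type u) [Group P] [TopologicalSpace P] [DiscreteTopology P] [Finite P],
      IsPGroup p P → ∀ f : ι → P, Tendsto f cofinite (𝓝 1) →
        ∃ φ : G →ₜ* P, ∀ i, φ (x i) = f i) :
    IsFreeProP p x where
  isProP := hG
  tendsto_one := hx1
  existsUnique_lift P _ _ hP f hf := by
    have := hG.compactSpace
    have := hG.t2Space
    have := hP.isTopologicalGroup
    have := hP.compactSpace
    have := hP.t2Space
    refine existsUnique_of_exists_of_unique ?_ fun φ ψ hφ hψ => ?_
    · refine exists_lift_of_graph hx
        (Subgroup.closure (Set.range fun i => (x i, f i))).topologicalClosure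
        (Subgroup.isClosed_topologicalClosure _) f
        (fun i => Subgroup.le_topologicalClosure _ (Subgroup.subset_closure ⟨i, rfl⟩)) ?_
      -- A point `(1, b)` with `b ≠ 1` would survive in some finite quotient `P ⧸ U`; there the
      -- given lift `φ` forces every `(g, b)` in the closed subgroup to satisfy `φ g = b` mod `U`.
      intro b hb
      by_contra hb1
      obtain ⟨U, hUn, hUo, hU⟩ := hP.exists_openNormal_le
        (isOpen_compl_singleton.mem_nhds (show (1 : P) ∈ ({b}ᶜ : Set P) from Ne.symm hb1))
      have := QuotientGroup.discreteTopology hUo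
      have := hP.finite_quotient U hUo
      have hmk : Continuous (QuotientGroup.mk' U) := continuous_quot_mk
      obtain ⟨φ, hφ⟩ := H (P ⧸ U) (hP.isPGroup_quotient U hUo) (fun i => QuotientGroup.mk' U (f i))
        (by simpa using (hmk.tendsto 1).comp hf)
      let φ₁ : G × P →* P ⧸ U := φ.toMonoidHom.comp (MonoidHom.fst G P)
      let φ₂ : G × P →* P ⧸ U := (QuotientGroup.mk' U).comp (MonoidHom.snd G P)
      have hle : (Subgroup.closure (Set.range fun i => (x i, f i))).topologicalClosure ≤
          φ₁.eqLocus φ₂ := by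
        refine Subgroup.topologicalClosure_minimal _ ?_
          (isClosed_eq (φ.continuous_toFun.comp continuous_fst) (hmk.comp continuous_snd))
        rw [Subgroup.closure_le]
        rintro _ ⟨i, rfl⟩
        exact hφ i
      have h2 : φ 1 = QuotientGroup.mk' U b := hle hb
      rw [map_one] at h2
      have h3 : b ∈ U := (QuotientGroup.eq_one_iff b).1 h2.symm
      exact hU h3 rfl
    · have := eq_of_eqOn_topologicalGenerators hx (φ := φ.toMonoidHom) (ψ := ψ.toMonoidHom)
        φ.continuous_toFun ψ.continuous_toFun fun i => (hφ i).trans (hψ i).symm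
      ext g
      exact DFunLike.congr_fun this g

/-! ### Central series and commutator sequences in finite `p`-groups -/

/-- A finite `p`-group has a finite descending central series with elementary abelian factors. -/
theorem IsPGroup.exists_central_elementary_series {p : ℕ} [Fact p.Prime] :
    ∀ (m : ℕ) {P : Type u} [Group P] [Finite P], IsPGroup p P → Nat.card P ≤ m →
      ∃ (n : ℕ) (D : ℕ → Subgroup P), D 0 = ⊤ ∧ D n = ⊥ ∧ (∀ k, (D k).Normal) ∧
        (∀ k, ∀ g ∈ D k, g ^ p ∈ D (k + 1)) ∧ ∀ k, ∀ h : P, ∀ g ∈ D k, ⁅h, g⁆ ∈ D (k + 1) := by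
  intro m
  induction m with
  | zero =>
    intro P _ _ _ h
    exact absurd h (by have := Nat.card_pos (α := P); omega)
  | succ m ih =>
    intro P _ _ hP hm
    rcases subsingleton_or_nontrivial P with hs | hnt
    · refine ⟨0, fun _ => ⊤, rfl, Subsingleton.elim _ _, fun _ => inferInstance, fun _ _ _ => trivial,
        fun _ _ _ _ => trivial⟩
    have := hP.center_nontrivial
    obtain ⟨c, hc0, hc⟩ := (IsPGroup.nontrivial_iff_card (hP.to_subgroup (Subgroup.center P))).1 this
    obtain ⟨z, hz⟩ := exists_prime_orderOf_dvd_card' p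
      (show p ∣ Nat.card (Subgroup.center P) from
        hc ▸ dvd_pow_self p hc0.ne')
    have hzo : orderOf (z : P) = p := by rw [Subgroup.orderOf_coe, hz]
    let Z : Subgroup P := Subgroup.zpowers (z : P)
    have hZc : Z ≤ Subgroup.center P := by
      rw [Subgroup.zpowers_le]; exact z.2
    have hZn : Z.Normal := ⟨fun g hg h => by
      rw [Subgroup.mem_center_iff.1 (hZc hg) h, mul_inv_cancel_right]; exact hg⟩
    have hZp : ∀ g ∈ Z, g ^ p = 1 := by
      rintro _ ⟨i, rfl⟩
      change ((z : P) ^ i) ^ p = 1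
      rw [← zpow_natCast, ← zpow_mul, mul_comm, zpow_mul, zpow_natCast, ← hzo,
        pow_orderOf_eq_one, one_zpow]
    have hcard : Nat.card (P ⧸ Z) ≤ m := by
      have h1 := Subgroup.card_eq_card_quotient_mul_card_subgroup Z
      rw [Nat.card_zpowers, hzo] at h1
      have h2 : Nat.card (P ⧸ Z) * 2 ≤ Nat.card (P ⧸ Z) * p :=
        Nat.mul_le_mul_left _ (Fact.out : p.Prime).two_le
      have h3 := Nat.card_pos (α := P ⧸ Z)
      omega
    obtain ⟨n, D, h0, hn, hnorm, hpow, hcomm⟩ := ih (hP.to_quotient Z) hcard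
    -- Since `D n = ⊥` in the quotient, the preimage at `k = n` is the central subgroup `Z` of order
    -- `p`; one more step reaches `⊥`.
    refine ⟨n + 1, fun k => if k ≤ n then (D k).comap (QuotientGroup.mk' Z) else ⊥, ?_, ?_, ?_, ?_, ?_⟩
    · simp [h0]
    · simp
    · intro k
      have := hnorm k
      by_cases hk : k ≤ n <;> simp only [hk, if_true, if_false] <;> infer_instance
    · intro k g hg
      by_cases hk : k + 1 ≤ n
      · simp only [hk, if_true, (by omega : k ≤ n)] at hg ⊢
        simpa using hpow k _ hg
      · by_cases hk' : k ≤ n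
        · obtain rfl : k = n := by omega
          simp only [le_refl, if_true, hn, hk, if_false] at hg ⊢
          exact hZp g ((QuotientGroup.eq_one_iff g).1 hg)
        · simp only [hk', if_false, hk] at hg ⊢
          simp [Subgroup.mem_bot.1 hg]
    · intro k h g hg
      by_cases hk : k + 1 ≤ n
      · simp only [hk, if_true, (by omega : k ≤ n)] at hg ⊢
        simpa using hcomm k (h : P ⧸ Z) _ hg
      · by_cases hk' : k ≤ n
        · obtain rfl : k = n := by omega
          simp only [le_refl, if_true, hn, hk, if_false] at hg ⊢
          have := Subgroup.mem_center_iff.1 (hZc ((QuotientGroup.eq_one_iff g).1 hg)) h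
          rw [Subgroup.mem_bot, commutatorElement_def, this]
          group
        · simp only [hk', if_false, hk] at hg ⊢
          simp [Subgroup.mem_bot.1 hg]

section CommSeq

variable {p : ℕ} [Fact p.Prime]

theorem map_commSeq {G : Type*} [Group G] [TopologicalSpace G] (hG : IsProP p G)
    {P : Type*} [Group P] [TopologicalSpace P] (hP : IsProP p P)
    (φ : G →* P) (hφ : Continuous φ) (y x : G) (a : ℕ → ℤ_[p]) (j : ℕ) :
    φ (commSeq p y x a j) = commSeq p (φ y) (φ x) a j := by
  induction j with
  | zero => rfl
  | succ j ih =>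
    simp only [commSeq, map_mul, map_commutatorElement, ih, map_padicPow hG hP φ hφ]

/-- Commutators and `p`-th powers both descend one step in the central series, so the length of the
series bounds the number of nontrivial terms, uniformly in `y`, `x` and `a`. -/
theorem commSeq_eventually_eq_one {P : Type u} [Group P] [TopologicalSpace P]
    [DiscreteTopology P] [Finite P] (hP : IsPGroup p P) :
    ∃ n, ∀ (y x : P) (a : ℕ → ℤ_[p]), ∀ j ≥ n, commSeq p y x a j = 1 := by
  obtain ⟨n, D, h0, hn, hnorm, hpow, hcomm⟩ := IsPGroup.exists_central_elementary_series _ hP le_rfl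
  obtain ⟨k, hk⟩ := IsPGroup.iff_card.1 hP
  have key : ∀ (y x : P) (a : ℕ → ℤ_[p]) (j : ℕ), commSeq p y x a j ∈ D j := by
    intro y x a j
    induction j with
    | zero => simp [h0]
    | succ j ih =>
      refine Subgroup.mul_mem _ (hcomm j y _ ih) ?_
      rw [padicPow_eq_pow_appr (IsProP.of_finite hP) (k := k) (by rw [← hk, pow_card_eq_one'])]
      obtain ⟨c, hc⟩ := dvd_appr_mul (a j) k
      rw [hc, pow_mul]
      exact Subgroup.pow_mem _ (hpow j _ ih) _
  refine ⟨n, fun y x a j hj => ?_⟩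
  induction j, hj using Nat.le_induction with
  | base => simpa [hn] using key y x a n
  | succ j hj ih =>
    rw [commSeq, ih, commutatorElement_one_right, one_mul,
      padicPow_eq_pow_appr (IsProP.of_finite hP) (k := 0) (by simp), one_pow]

end CommSeq

/-! ### Periodicity of recursions in finite `p`-groups -/

/-- Iterating `v ↦ g v ^ q` with `q ≡ 1` modulo `p` and periodic coefficients `g` in a finite
`p`-group gives a periodic sequence, whose period is bounded independently of the sequence. -/
theorem exists_periodic_of_skew_recursion {p : ℕ} [Fact p.Prime] {P : Type u} [Group P] [Finite P]
    (hP : IsPGroup p P) :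
    ∃ n, ∀ (m : ℕ) (g v : ℕ → P) (q : ℤ), (p : ℤ) ∣ q - 1 → (∀ t, g (t + p ^ m) = g t) →
      (∀ t, v (t + 1) = g t * v t ^ q) → ∀ t, v (t + p ^ (m + n)) = v t := by
  obtain ⟨n, D, h0, hn, hnorm, hpow, hcomm⟩ := IsPGroup.exists_central_elementary_series _ hP le_rfl
  refine ⟨n, fun m g v q hq hg hv => ?_⟩
  have hgm : ∀ s t, g (t + s * p ^ m) = g t := by
    intro s
    induction s with
    | zero => simp
    | succ s ih => intro t; rw [Nat.succ_mul, ← add_assoc, hg, ih]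
  -- Each layer of the series costs one factor `p`. Modulo `D (k + 1)` the discrepancy `z` over one
  -- period `M` is central with `z ^ p = 1`, hence `z ^ q = z`; a shift by `M` multiplies every term
  -- by `z`, and a shift by `p * M` changes nothing.
  have key : ∀ k, ∀ t, (v t)⁻¹ * v (t + p ^ (m + k)) ∈ D k := by
    intro k
    induction k with
    | zero => simp [h0]
    | succ k ih =>
      set M := p ^ (m + k) with hM
      set z := (v 0)⁻¹ * v M with hz
      have hzD : z ∈ D k := by simpa using ih 0
      have := hnorm (k + 1)
      let μ := QuotientGroup.mk' (D (k + 1))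
      have hμ : ∀ w ∈ D (k + 1), μ w = 1 := fun w hw => (QuotientGroup.eq_one_iff w).2 hw
      have hzp : μ z ^ p = 1 := by rw [← map_pow, hμ _ (hpow k z hzD)]
      have hzc : ∀ w, Commute (μ w) (μ z) := fun w => by
        rw [← commutatorElement_eq_one_iff_commute, ← map_commutatorElement, hμ _ (hcomm k w z hzD)]
      have hzq : μ z ^ q = μ z := by
        obtain ⟨c, hc⟩ := hq
        obtain rfl : q = 1 + p * c := by omega
        rw [zpow_add, zpow_one, zpow_mul, zpow_natCast, hzp, one_zpow, mul_one]
      have hshift : ∀ t, μ (v (t + M)) = μ (v t) * μ z := by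
        intro t
        induction t with
        | zero => rw [← map_mul, hz, mul_inv_cancel_left, zero_add]
        | succ t iht =>
          have hgM : g (t + M) = g t := by
            rw [hM, pow_add, mul_comm, hgm]
          rw [add_right_comm, hv, hv, hgM, map_mul μ (g t), map_zpow, iht, (hzc _).mul_zpow, hzq,
            map_mul μ (g t), map_zpow, mul_assoc]
      have hmul : ∀ s t, μ (v (t + s * M)) = μ (v t) * μ z ^ s := by
        intro s
        induction s with
        | zero => simp
        | succ s ihs => intro t; rw [Nat.succ_mul, ← add_assoc, hshift, ihs, pow_succ, mul_assoc]
      intro t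
      have h := hmul p t
      rw [hzp, mul_one, hM, ← pow_succ'] at h
      rw [← (QuotientGroup.eq_one_iff _ : _ ↔ _ ∈ D (k + 1))]
      change μ _ = 1
      rw [map_mul, map_inv, ← add_assoc, h, inv_mul_cancel]
  intro t
  have := key n t
  rw [hn, Subgroup.mem_bot] at this
  exact (inv_mul_eq_one.1 this).symm

/-- The sequences `X j`, where `X j (t + 1) = X (j + 1) t * X j t ^ q j` with `q j ≡ 1` modulo `p`
and `X j = 1` for `j ≥ N`, have a common period which is a power of `p` and depends on `N` only. -/
theorem exists_period_of_triangular_recursion {p : ℕ} [Fact p.Prime] {P : Type u} [Group P]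
    [Finite P] (hP : IsPGroup p P) (N : ℕ) :
    ∃ m, ∀ (X : ℕ → ℕ → P) (q : ℕ → ℤ), (∀ j, (p : ℤ) ∣ q j - 1) →
      (∀ j t, X j (t + 1) = X (j + 1) t * X j t ^ q j) → (∀ j ≥ N, ∀ t, X j t = 1) →
      ∀ j t, X j (t + p ^ m) = X j t := by
  obtain ⟨n, hn⟩ := exists_periodic_of_skew_recursion hP
  refine ⟨n * N, fun X q hq hX hN => ?_⟩
  -- Induction downwards from `j = N`: the sequence `X (j + 1)` serves as the periodic coefficients
  -- for `X j`, and each level adds `n` to the exponent of the period.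
  have key : ∀ l j, N ≤ j + l → ∀ t, X j (t + p ^ (n * l)) = X j t := by
    intro l
    induction l with
    | zero => intro j hj t; rw [hN j hj, hN j hj]
    | succ l ih =>
      intro j hj
      exact hn (n * l) (X (j + 1)) (X j) (q j) (hq j) (ih (j + 1) (by omega)) (hX j)
  exact fun j => key N j (by omega)

/-! ### Generation of the closed normal subgroup: part (a) -/

theorem closedNormalClosure_isClosed {G : Type*} [Group G] [TopologicalSpace G]
    [IsTopologicalGroup G] {ι : Type*} (x : ι → G) : IsClosed (closedNormalClosure x : Set G) :=
  Subgroup.isClosed_topologicalClosure _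

theorem mem_closedNormalClosure {G : Type*} [Group G] [TopologicalSpace G]
    [IsTopologicalGroup G] {ι : Type*} (x : ι → G) (i : ι) : x i ∈ closedNormalClosure x :=
  Subgroup.le_topologicalClosure _ (Subgroup.subset_normalClosure ⟨i, rfl⟩)

theorem closedNormalClosure_normal {G : Type*} [Group G] [TopologicalSpace G]
    [IsTopologicalGroup G] {ι : Type*} (x : ι → G) : (closedNormalClosure x).Normal :=
  Subgroup.is_normal_topologicalClosure _

/-- A closed subgroup of a compact group mapped into itself by conjugation with the members of a
topologically generating set is normal. -/
theorem Subgroup.normal_of_isClosed_of_conj_mem {G : Type*} [Group G] [TopologicalSpace G]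
    [IsTopologicalGroup G] [CompactSpace G] {S : Set G}
    (hS : (Subgroup.closure S).topologicalClosure = ⊤) (K : Subgroup G) (hK : IsClosed (K : Set G))
    (h : ∀ s ∈ S, ∀ k ∈ K, s * k * s⁻¹ ∈ K) : K.Normal := by
  let M : Submonoid G :=
    { carrier := {g | ∀ k ∈ K, g * k * g⁻¹ ∈ K}
      one_mem' := fun k hk => by simpa using hk
      mul_mem' := fun {g g'} hg hg' k hk => by
        have := hg _ (hg' k hk)
        simpa [mul_assoc] using this }
  have hM : IsClosed (M : Set G) := by
    have : (M : Set G) = ⋂ k ∈ K, (fun g => g * k * g⁻¹) ⁻¹' (K : Set G) := by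
      ext g
      simp [M]
    rw [this]
    exact isClosed_biInter fun k _ => hK.preimage (by fun_prop)
  -- The elements conjugating `K` into itself visibly form only a submonoid; compactness supplies
  -- inverses, as the closed submonoid and the closed subgroup generated by `S` coincide.
  have hle : (Submonoid.closure S).topologicalClosure ≤ M :=
    Submonoid.topologicalClosure_minimal _ (Submonoid.closure_le.2 h) hM
  rw [← topologicalClosure_subgroupClosure_toSubmonoid] at hle
  refine ⟨fun k hk g => hle ?_ k hk⟩
  have : g ∈ (Subgroup.closure S).topologicalClosure := hS ▸ Subgroup.mem_top g
  exact this

theorem IsProP.padicPow_mem {p : ℕ} [Fact p.Prime] {G : Type*} [Group G] [TopologicalSpace G]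
    (hG : IsProP p G) {K : Subgroup G} (hK : IsClosed (K : Set G)) {g : G} (hg : g ∈ K)
    (b : ℤ_[p]) : padicPow p g b ∈ K :=
  hK.mem_of_tendsto (tendsto_padicPow hG g b) (Eventually.of_forall fun _ => K.pow_mem hg _)

section CommFamily

variable {p : ℕ} [Fact p.Prime] {F : Type u} [Group F] [TopologicalSpace F]
  [IsTopologicalGroup F] {ι : Type v} {y : F} {x : ι → F}

theorem closedNormalClosure_le_of_commSeq_mem (hF : IsProP p F)
    (hgen : (Subgroup.closure (insert y (Set.range x))).topologicalClosure = ⊤)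
    (a : ι → ℕ → ℤ_[p]) :
    closedNormalClosure x ≤ (Subgroup.closure
      (Set.range fun ij : ι × ℕ => commSeq p y (x ij.1) (a ij.1) ij.2)).topologicalClosure := by
  have := hF.compactSpace
  set K := (Subgroup.closure
    (Set.range fun ij : ι × ℕ => commSeq p y (x ij.1) (a ij.1) ij.2)).topologicalClosure with hKdef
  have hK : IsClosed (K : Set F) := Subgroup.isClosed_topologicalClosure _
  have hmem : ∀ i j, commSeq p y (x i) (a i) j ∈ K := fun i j =>
    Subgroup.le_topologicalClosure _ (Subgroup.subset_closure ⟨(i, j), rfl⟩)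
  have hKn : K.Normal := by
    refine K.normal_of_isClosed_of_conj_mem hgen hK ?_
    rintro s (rfl | ⟨i, rfl⟩)
    · suffices K ≤ K.comap (MulAut.conj s).toMonoidHom from fun k hk => this hk
      refine Subgroup.topologicalClosure_minimal _ ?_
        (hK.preimage (show Continuous fun k => s * k * s⁻¹ by fun_prop))
      rw [Subgroup.closure_le]
      rintro _ ⟨⟨i, j⟩, rfl⟩
      -- The recursion solved for the conjugate of term `j` by `s = y`: term `j + 1`, times the
      -- inverse of the `p`-adic power, times term `j`.
      have h1 := K.mul_mem (hmem i (j + 1))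
        (K.inv_mem (hF.padicPow_mem hK (hmem i j) (p * a i j)))
      have h2 := K.mul_mem h1 (hmem i j)
      change s * commSeq p s (x i) (a i) j * s⁻¹ ∈ K
      simpa [commSeq, commutatorElement_def] using h2
    · intro k hk
      have := hmem i 0
      exact K.mul_mem (K.mul_mem this hk) (K.inv_mem this)
  refine Subgroup.topologicalClosure_minimal _ (Subgroup.normalClosure_le_normal ?_) hK
  rintro _ ⟨i, rfl⟩
  exact hmem i 0

theorem topologicalClosure_range_commSeq (hF : IsProP p F)
    (hgen : (Subgroup.closure (insert y (Set.range x))).topologicalClosure = ⊤)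
    (a : ι → ℕ → ℤ_[p]) :
    (Subgroup.closure
      (Set.range fun ij : ι × ℕ => commSeq p y (x ij.1) (a ij.1) ij.2)).topologicalClosure =
        closedNormalClosure x := by
  refine le_antisymm ?_ (closedNormalClosure_le_of_commSeq_mem hF hgen a)
  refine Subgroup.topologicalClosure_minimal _ ?_ (closedNormalClosure_isClosed x)
  rw [Subgroup.closure_le]
  rintro _ ⟨⟨i, j⟩, rfl⟩
  exact commSeq_mem hF y x a i j

theorem topologicalClosure_range_commFamily (hF : IsProP p F)
    (hgen : (Subgroup.closure (insert y (Set.range x))).topologicalClosure = ⊤)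
    (a : ι → ℕ → ℤ_[p]) :
    (Subgroup.closure (Set.range (commFamily hF y x a))).topologicalClosure = ⊤ := by
  set H := closedNormalClosure x
  set K := (Subgroup.closure (Set.range (commFamily hF y x a))).topologicalClosure
  have hK' : IsClosed (K : Set H) := Subgroup.isClosed_topologicalClosure _
  have hK : IsClosed (K.map H.subtype : Set F) :=
    (closedNormalClosure_isClosed x).isClosedEmbedding_subtypeVal.isClosedMap _ hK'
  have hle : H ≤ K.map H.subtype := by
    refine (closedNormalClosure_le_of_commSeq_mem hF hgen a).trans
      (Subgroup.topologicalClosure_minimal _ ?_ hK)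
    rw [Subgroup.closure_le]
    rintro _ ⟨ij, rfl⟩
    exact ⟨commFamily hF y x a ij,
      Subgroup.le_topologicalClosure _ (Subgroup.subset_closure ⟨ij, rfl⟩), rfl⟩
  rw [eq_top_iff]
  rintro ⟨h, hh⟩ -
  obtain ⟨⟨k, hk'⟩, hk, rfl⟩ := hle hh
  exact hk

/-- The bound in `commSeq_eventually_eq_one`, applied modulo an open normal subgroup, does not
depend on `i`; finiteness of `ι` then leaves finitely many exceptions. -/
theorem tendsto_commFamily (hF : IsProP p F) [Finite ι] (a : ι → ℕ → ℤ_[p]) :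
    Tendsto (commFamily hF y x a) cofinite (𝓝 1) := by
  rw [nhds_subtype_eq_comap, tendsto_comap_iff]
  intro V hV
  obtain ⟨U, hUn, hUo, hUV⟩ := hF.exists_openNormal_le (V := V) (by simpa using hV)
  have := QuotientGroup.discreteTopology hUo
  have := hF.finite_quotient U hUo
  have hp := hF.isPGroup_quotient U hUo
  obtain ⟨n, hn⟩ := commSeq_eventually_eq_one (p := p) hp
  refine (Set.toFinite ((Set.univ : Set ι) ×ˢ Set.Iio n)).subset ?_
  rintro ⟨i, j⟩ hij
  by_contra hj
  have hj : n ≤ j := by simpa using hj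
  refine hij (hUV ?_)
  change commSeq p y (x i) (a i) j ∈ U
  rw [← QuotientGroup.eq_one_iff]
  change QuotientGroup.mk' U _ = 1
  rw [map_commSeq hF (IsProP.of_finite hp) (QuotientGroup.mk' U) continuous_quot_mk, hn _ _ _ j hj]

theorem conjNormal_commFamily (hF : IsProP p F) (a : ι → ℕ → ℤ_[p]) (i : ι) (j : ℕ) :
    haveI := closedNormalClosure_normal x
    MulAut.conjNormal y (commFamily hF y x a (i, j)) =
      commFamily hF y x a (i, j + 1) *
        (padicPow p (commFamily hF y x a (i, j)) (p * a i j))⁻¹ * commFamily hF y x a (i, j) := by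
  have := closedNormalClosure_normal x
  refine Subtype.ext ?_
  have h := map_padicPow (hF.subgroup _ (closedNormalClosure_isClosed x)) hF
    (closedNormalClosure x).subtype continuous_subtype_val (commFamily hF y x a (i, j)) (p * a i j)
  simp only [Subgroup.coe_subtype] at h
  simp only [MulAut.conjNormal_apply, Subgroup.coe_mul, Subgroup.coe_inv, h]
  simp [commFamily, commSeq, commutatorElement_def]

end CommFamily

/-! ### The triangular permutation and lifts from `H`: part (b) -/

section TriangularMap

variable {p : ℕ} {P : Type u} [Group P] {r N : ℕ}

/-- The coordinates of `u : Fin r → Fin N → P`, extended by `1`. -/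
def extCoord (i : Fin r) (j : ℕ) (u : Fin r → Fin N → P) : P :=
  if h : j < N then u i ⟨j, h⟩ else 1

/-- The map `u ↦ (i, j) ↦ u (i, j + 1) * u (i, j) ^ q (i, j)`. -/
def triangularMap (q : Fin r → ℕ → ℤ) (u : Fin r → Fin N → P) : Fin r → Fin N → P :=
  fun i j => extCoord i (j + 1) u * extCoord i j u ^ q i j

/-- The default value `1` outside the array makes the recursion hold for every `j`, also at and
beyond the edge `N`. -/
theorem extCoord_triangularMap (q : Fin r → ℕ → ℤ) (i : Fin r) (j : ℕ) (u : Fin r → Fin N → P) :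
    extCoord i j (triangularMap q u) = extCoord i (j + 1) u * extCoord i j u ^ q i j := by
  by_cases h : j < N
  · simp [extCoord, triangularMap, h]
  · have h' : ¬ j + 1 < N := by omega
    simp only [extCoord, h, h', dif_neg, not_false_iff, one_zpow, mul_one]

/-- Along an orbit the coordinates satisfy the recursion of `exists_period_of_triangular_recursion`,
time being the number of iterations. -/
theorem exists_iterate_triangularMap_eq [Fact p.Prime] [Finite P] (hP : IsPGroup p P) (r N : ℕ) :
    ∃ m, ∀ q : Fin r → ℕ → ℤ, (∀ i j, (p : ℤ) ∣ q i j - 1) →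
      ∀ u : Fin r → Fin N → P, (triangularMap q)^[p ^ m] u = u := by
  obtain ⟨m, hm⟩ := exists_period_of_triangular_recursion hP N
  refine ⟨m, fun q hq u => ?_⟩
  have key : ∀ i j, extCoord i j ((triangularMap q)^[p ^ m] u) = extCoord i j u := by
    intro i j
    have := hm (fun j t => extCoord i j ((triangularMap q)^[t] u)) (q i) (hq i)
      (fun j t => by rw [Function.iterate_succ_apply', extCoord_triangularMap])
      (fun j hj t => by simp [extCoord, not_lt.2 hj]) j 0
    simpa using this
  ext i j
  simpa [extCoord] using key i j

end TriangularMap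

theorem SemidirectProduct.left_mul_of_right_eq_one {N G : Type*} [Group N] [Group G]
    {φ : G →* MulAut N} {a : N ⋊[φ] G} (ha : a.right = 1) (b : N ⋊[φ] G) :
    (a * b).left = a.left * b.left := by
  rw [SemidirectProduct.mul_left, ha, map_one, MulAut.one_apply]

/-- If `F` is free pro-`p` on `y` and the `x i`, then `commFamily` has lifts to finite `p`-groups `P`:
for coordinate functions `extCoord`, a lift of `F` to `P ^ Ω ⋊ ⟨σ⟩`, with `σ` the permutation
`triangularMap` of a finite set `Ω` of arrays in `P`, is evaluated at the array to be hit. -/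
theorem exists_lift_commFamily {p : ℕ} [Fact p.Prime] {r : ℕ} {F : Type u} [Group F]
    [TopologicalSpace F] [IsTopologicalGroup F] (hF : IsProP p F) {y : F} {x : Fin r → F}
    (hfree : IsFreeProP p (Fin.cons y x : Fin (r + 1) → F)) (a : Fin r → ℕ → ℤ_[p])
    (P : Type u) [Group P] [TopologicalSpace P] [DiscreteTopology P] [Finite P]
    (hP : IsPGroup p P) (f : Fin r × ℕ → P) (hf : Tendsto f cofinite (𝓝 1)) :
    ∃ φ : closedNormalClosure x →ₜ* P, ∀ ij, φ (commFamily hF y x a ij) = f ij := by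
  obtain ⟨k, hk⟩ := IsPGroup.iff_card.1 hP
  -- the support of `f`
  obtain ⟨N, hN⟩ : ∃ N, ∀ i, ∀ j ≥ N, f (i, j) = 1 := by
    have hfin : {ij | ¬ f ij = 1}.Finite := by
      simpa [nhds_discrete] using hf
    obtain ⟨N, hN⟩ := (hfin.image Prod.snd).bddAbove
    refine ⟨N + 1, fun i j hj => ?_⟩
    by_contra h
    have := hN ⟨(i, j), h, rfl⟩
    simp only at this
    omega
  -- All exponents matter only modulo `|P| = p ^ k`, so the `p`-adic `p * a i j` is replaced by its
  -- residue `c i j`.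
  let c : Fin r → ℕ → ℕ := fun i j => ((p : ℤ_[p]) * a i j).appr k
  let q : Fin r → ℕ → ℤ := fun i j => 1 - c i j
  have hq : ∀ i j, (p : ℤ) ∣ q i j - 1 := fun i j => by
    have : (p : ℤ) ∣ c i j := Int.natCast_dvd_natCast.2 (dvd_appr_mul (a i j) k)
    simpa [q] using this
  obtain ⟨m, hm⟩ := exists_iterate_triangularMap_eq hP r N
  let T : (Fin r → Fin N → P) → Fin r → Fin N → P := triangularMap q
  have hT : ∀ u, T^[p ^ m] u = u := hm q hq
  have hpm : p ^ m = (p ^ m - 1) + 1 :=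
    (Nat.sub_add_cancel (pow_pos (Fact.out : p.Prime).pos m)).symm
  let σ : Equiv.Perm (Fin r → Fin N → P) :=
    { toFun := T
      invFun := T^[p ^ m - 1]
      left_inv := fun u => (Function.iterate_succ_apply T _ u).symm.trans (hpm ▸ hT u)
      right_inv := fun u => (Function.iterate_succ_apply' T _ u).symm.trans (hpm ▸ hT u) }
  have hσ : σ ^ p ^ m = 1 := by
    ext1 u
    rw [Equiv.Perm.coe_pow]
    exact hT u
  let C := Subgroup.zpowers σ
  obtain ⟨m', -, hm'⟩ := (Nat.dvd_prime_pow Fact.out).1 (orderOf_dvd_of_pow_eq_one hσ)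
  have hC : Nat.card C = p ^ m' := by rw [Nat.card_zpowers, hm']
  let W := ((Fin r → Fin N → P) → P) ⋊[mulAutArrow] C
  have hWcard : Nat.card W =
      p ^ (k * Nat.card (Fin r → Fin N → P) + m') := by
    rw [SemidirectProduct.card, hC, Nat.card_fun, hk, pow_add, pow_mul]
  have hWfin : Finite W := Nat.finite_of_card_ne_zero
    (hWcard ▸ (pow_pos (Fact.out : p.Prime).pos _).ne')
  let _ : TopologicalSpace W := ⊥
  have : DiscreteTopology W := ⟨rfl⟩
  have hW : IsProP p W := IsProP.of_finite (IsPGroup.of_card hWcard)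
  let e : Fin r → ℕ → ((Fin r → Fin N → P) → P) := extCoord
  let s : C := ⟨σ, Subgroup.mem_zpowers σ⟩
  -- `mulAutArrow` precomposes with the inverse, so `s⁻¹` is what makes conjugation by `Y`
  -- precompose with `σ`.
  let Y : W := SemidirectProduct.inr s⁻¹
  have hconj : ∀ i j, Y * SemidirectProduct.inl (e i j) * Y⁻¹ =
      SemidirectProduct.inl (e i (j + 1) * e i j ^ q i j) := by
    intro i j
    rw [← map_inv, ← SemidirectProduct.inl_aut]
    congr 1
    ext u
    change extCoord i j (((s⁻¹)⁻¹ : C) • u) = _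
    rw [inv_inv]
    exact extCoord_triangularMap q i j u
  obtain ⟨Ψ, hΨ, -⟩ := hfree.existsUnique_lift W hW
    (Fin.cons Y fun i => SemidirectProduct.inl (e i 0)) (by simp [cofinite_eq_bot])
  have hΨy : Ψ y = Y := by simpa using hΨ 0
  have hΨx : ∀ i, Ψ (x i) = SemidirectProduct.inl (e i 0) := fun i => by simpa using hΨ i.succ
  have hseq : ∀ i j, Ψ (commSeq p y (x i) (a i) j) = SemidirectProduct.inl (e i j) := by
    intro i j
    have := map_commSeq hF hW Ψ.toMonoidHom Ψ.continuous_toFun y (x i) (a i) j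
    refine this.trans ?_
    change commSeq p (Ψ y) (Ψ (x i)) (a i) j = _
    rw [hΨy, hΨx]
    induction j with
    | zero => rfl
    | succ j ih =>
      have hexp : (SemidirectProduct.inl (e i j) : W) ^ p ^ k = 1 := by
        rw [← map_pow]
        have : e i j ^ p ^ k = 1 := by
          ext u
          rw [Pi.pow_apply, ← hk, pow_card_eq_one', Pi.one_apply]
        rw [this, map_one]
      have ih' := ih (map_commSeq hF hW Ψ.toMonoidHom Ψ.continuous_toFun y (x i) (a i) j)
      rw [commSeq, ih', padicPow_eq_pow_appr hW hexp, commutatorElement_def, hconj, ← map_inv,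
        ← map_pow, ← map_mul, ← map_mul]
      congr 1
      change e i (j + 1) * e i j ^ (1 - (c i j : ℤ)) * (e i j)⁻¹ * e i j ^ c i j = _
      rw [zpow_sub, zpow_natCast]
      group
  -- `H` lands in the base group `P ^ Ω`, where evaluation at a point is multiplicative.
  have hright : ∀ h ∈ closedNormalClosure x, (Ψ h).right = 1 := by
    let R : F →* C := SemidirectProduct.rightHom.comp Ψ.toMonoidHom
    have hR : IsClosed (R.ker : Set F) := by
      have : IsClosed {w : W | w.right = 1} := isClosed_discrete _
      exact this.preimage Ψ.continuous_toFun
    refine Subgroup.topologicalClosure_minimal _ (Subgroup.normalClosure_le_normal (N := R.ker) ?_) hR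
    rintro _ ⟨i, rfl⟩
    change (Ψ (x i)).right = 1
    rw [hΨx, SemidirectProduct.right_inl]
  let u₀ : Fin r → Fin N → P := fun i j => f (i, j)
  refine ⟨⟨⟨⟨fun h => (Ψ h).left u₀, by simp⟩, fun h h' => ?_⟩, ?_⟩, ?_⟩
  · simp only [Subgroup.coe_mul, map_mul]
    rw [SemidirectProduct.left_mul_of_right_eq_one (hright h h.2), Pi.mul_apply]
  · have : Continuous fun w : W => w.left u₀ := continuous_of_discreteTopology
    exact this.comp (Ψ.continuous_toFun.comp continuous_subtype_val)
  · rintro ⟨i, j⟩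
    change (Ψ (commSeq p y (x i) (a i) j)).left u₀ = f (i, j)
    rw [hseq, SemidirectProduct.left_inl]
    change extCoord i j u₀ = f (i, j)
    by_cases hj : j < N
    · simp [extCoord, hj, u₀]
    · simp [extCoord, hj, hN i j (not_lt.1 hj)]

/-! ### Extension from `H` to `F`: part (c) -/

/-- If no `y ^ p ^ n` lies in the closed normal subgroup `H`, then modulo `H` and a small enough
open subgroup the order of `y` is divisible by any given power of `p`. -/
theorem IsProP.exists_openNormal_dvd {p : ℕ} [Fact p.Prime] {F : Type u} [Group F]
    [TopologicalSpace F] (hF : IsProP p F) {H : Subgroup F} [H.Normal] (hH : IsClosed (H : Set F))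
    {y : F} {k : ℕ} (hy : y ^ p ^ k ∉ H) :
    ∃ U : Subgroup F, U.Normal ∧ IsOpen (U : Set F) ∧
      ∀ h ∈ H, ∀ m : ℤ, h * y ^ m ∈ U → ((p ^ k : ℕ) : ℤ) ∣ m := by
  have := hF.isTopologicalGroup
  -- An open normal subgroup `U` inside this neighbourhood satisfies `y ^ p ^ k ∉ H U`, so the order
  -- of `y` modulo `H U`, a power of `p`, does not divide `p ^ k`.
  have hV : (fun g => y ^ p ^ k * g) ⁻¹' (H : Set F)ᶜ ∈ 𝓝 (1 : F) :=
    (hH.isOpen_compl.preimage (by fun_prop)).mem_nhds (by simpa using hy)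
  obtain ⟨U, hUn, hUo, hU⟩ := hF.exists_openNormal_le hV
  refine ⟨U, hUn, hUo, fun h hh m hm => ?_⟩
  obtain ⟨K, hK⟩ := hF.index_eq_pow U hUn hUo
  let J := H ⊔ U
  have hdvd : orderOf (y : F ⧸ J) ∣ p ^ K := by
    rw [orderOf_dvd_iff_pow_eq_one, ← QuotientGroup.mk_pow, QuotientGroup.eq_one_iff, ← hK]
    exact (le_sup_right : U ≤ J) (Subgroup.pow_index_mem U y)
  obtain ⟨s, -, hs⟩ := (Nat.dvd_prime_pow Fact.out).1 hdvd
  have hks : k ≤ s := by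
    by_contra! hlt
    have h1 : (y : F ⧸ J) ^ p ^ k = 1 := by
      rw [← orderOf_dvd_iff_pow_eq_one, hs]
      exact pow_dvd_pow p hlt.le
    rw [← QuotientGroup.mk_pow, QuotientGroup.eq_one_iff] at h1
    obtain ⟨g, hg, w, hw, hgw⟩ := Subgroup.mem_sup_of_normal_right.1 h1
    have := hU (U.inv_mem hw)
    simp [← hgw] at this
    exact this hg
  have h2 : (y : F ⧸ J) ^ m = 1 := by
    rw [← QuotientGroup.mk_zpow, QuotientGroup.eq_one_iff, ← inv_mul_cancel_left h (y ^ m)]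
    exact J.mul_mem ((le_sup_left : H ≤ J) (H.inv_mem hh)) ((le_sup_right : U ≤ J) hm)
  rw [← orderOf_dvd_iff_zpow_eq_one, hs] at h2
  exact (Int.natCast_dvd_natCast.2 (pow_dvd_pow p hks)).trans h2

/-- If `F` is topologically generated by `y` and elements of a closed normal subgroup `H` which
contains no `y ^ p ^ n`, then a homomorphism from `H` to a finite `p`-group that turns conjugation
by `y` into conjugation by `Y` extends to `F`, with `y` mapped to `Y`. -/
theorem exists_lift_of_equivariant {p : ℕ} [Fact p.Prime] {F : Type u} [Group F]
    [TopologicalSpace F] (hF : IsProP p F) {H : Subgroup F} [H.Normal] (hH : IsClosed (H : Set F))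
    {y : F} {ι : Type v} {x : ι → H}
    (hgen : haveI := hF.isTopologicalGroup
      (Subgroup.closure (insert y (Set.range fun i => (x i : F)))).topologicalClosure = ⊤)
    (hy : ∀ n : ℕ, y ^ p ^ n ∉ H)
    {P : Type*} [Group P] [TopologicalSpace P] [DiscreteTopology P] [Finite P]
    (hP : IsPGroup p P) (φ : H →ₜ* P) (Y : P)
    (hφ : ∀ h : H, φ (MulAut.conjNormal y h) = Y * φ h * Y⁻¹) :
    ∃ Φ : F →ₜ* P, Φ y = Y ∧ ∀ i, Φ (x i) = φ (x i) := by
  have := hF.isTopologicalGroup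
  have := hF.compactSpace
  have := hF.t2Space
  let A : Subgroup (F × P) := (H.subtype.prod φ.toMonoidHom).range
  have hA : ∀ h : H, ((h : F), φ h) ∈ A := fun h => ⟨h, rfl⟩
  have hconj : (y, Y) ∈ Subgroup.normalizer (A : Set (F × P)) := by
    rw [Subgroup.mem_normalizer_iff]
    rintro ⟨g, b⟩
    constructor
    · rintro ⟨h, hh⟩
      obtain ⟨rfl, rfl⟩ := Prod.ext_iff.1 hh
      exact ⟨MulAut.conjNormal y h, Prod.ext (by simp) (hφ h)⟩
    · rintro ⟨h, hh⟩
      obtain ⟨h1, h2⟩ := Prod.ext_iff.1 hh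
      refine ⟨(MulAut.conjNormal y).symm h, Prod.ext ?_ ?_⟩
      · have : (h : F) = y * g * y⁻¹ := h1
        simp [this, mul_assoc]
      · have h3 : φ h = Y * b * Y⁻¹ := h2
        have h4 := hφ ((MulAut.conjNormal y).symm h)
        rw [MulEquiv.apply_symm_apply, h3] at h4
        exact (mul_left_cancel (mul_right_cancel h4)).symm
  have hle : Subgroup.zpowers (y, Y) ≤ Subgroup.normalizer (A : Set (F × P)) := by
    rwa [Subgroup.zpowers_le]
  -- As `(y, Y)` normalizes the graph `A` of `φ`, every element of `Γ` is `(h y ^ m, φ h Y ^ m)`;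
  -- the closure of `Γ` will be the graph of the extension.
  let Γ := A ⊔ Subgroup.zpowers (y, Y)
  have hΓ : ∀ w ∈ Γ, ∃ (h : H) (m : ℤ), w = ((h : F) * y ^ m, φ h * Y ^ m) := by
    intro w hw
    rw [← SetLike.mem_coe, Subgroup.coe_mul_of_right_le_normalizer_left A _ hle] at hw
    obtain ⟨_, ⟨h, rfl⟩, _, ⟨m, rfl⟩, rfl⟩ := hw
    exact ⟨h, m, rfl⟩
  have hker : {g : F | ∀ hg : g ∈ H, φ ⟨g, hg⟩ = 1} ∈ 𝓝 (1 : F) := by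
    have h1 : {h : H | φ h = 1} ∈ 𝓝 (1 : H) :=
      φ.continuous_toFun.continuousAt.preimage_mem_nhds (t := {1})
        (by simp [nhds_discrete])
    rw [nhds_subtype_eq_comap, mem_comap] at h1
    obtain ⟨S, hS, hSV⟩ := h1
    exact mem_of_superset (x := S) hS fun g hg hgH => hSV (a := ⟨g, hgH⟩) hg
  obtain ⟨U, hUn, hUo, hU⟩ := hF.exists_openNormal_le hker
  obtain ⟨k₁, hk₁⟩ := hF.index_eq_pow U hUn hUo
  obtain ⟨k₂, hk₂⟩ := IsPGroup.iff_card.1 hP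
  -- With `p ^ k₁` the index of `U` and `p ^ k₂` the order of `P`, divisibility of `m` by `p ^ (k₁ +
  -- k₂)` puts `y ^ m` in `U` and makes `Y ^ m = 1`.
  obtain ⟨U', hUn', hUo', hU'⟩ := hF.exists_openNormal_dvd hH (hy (k₁ + k₂))
  have hfin : ∀ b, ((1 : F), b) ∈ Γ.topologicalClosure → b = 1 := by
    intro b hb
    have hopen : ((U : Set F) ∩ U') ×ˢ ({b} : Set P) ∈ 𝓝 ((1 : F), b) :=
      prod_mem_nhds (inter_mem (hUo.mem_nhds U.one_mem) (hUo'.mem_nhds U'.one_mem))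
        (by simp [nhds_discrete])
    -- `P` is discrete, so a nearby element of `Γ` has second coordinate exactly `b`.
    obtain ⟨w, ⟨⟨hwU, hwU'⟩, hwb⟩, hw⟩ := mem_closure_iff_nhds.1 hb _ hopen
    obtain ⟨h, m, rfl⟩ := hΓ w hw
    obtain ⟨c, rfl⟩ := hU' h h.2 m hwU'
    have hyU : y ^ (((p ^ (k₁ + k₂) : ℕ) : ℤ) * c) ∈ U := by
      rw [zpow_mul, zpow_natCast, pow_add, pow_mul, ← hk₁]
      exact U.zpow_mem (U.pow_mem (Subgroup.pow_index_mem U y) _) _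
    have hYc : Y ^ (((p ^ (k₁ + k₂) : ℕ) : ℤ) * c) = 1 := by
      rw [zpow_mul, zpow_natCast, add_comm, pow_add, pow_mul, ← hk₂, pow_card_eq_one', one_pow,
        one_zpow]
    have hhU : (h : F) ∈ U := (U.mul_mem_cancel_right hyU).1 hwU
    have hφh : φ h = 1 := hU hhU h.2
    have : φ h * Y ^ (((p ^ (k₁ + k₂) : ℕ) : ℤ) * c) = b := hwb
    rw [← this, hφh, hYc, mul_one]
  have hgen' : (Subgroup.closure (Set.range fun o : Option ι =>
      o.elim y fun i => (x i : F))).topologicalClosure = ⊤ := by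
    rw [← hgen]
    congr 2
    ext g
    simp [Set.range, Option.exists, eq_comm]
  obtain ⟨Φ, hΦ⟩ := exists_lift_of_graph hgen' Γ.topologicalClosure
    (Subgroup.isClosed_topologicalClosure _) (fun o : Option ι => o.elim Y fun i => φ (x i))
    (fun o => Subgroup.le_topologicalClosure _ <| by
      cases o with
      | none => exact (le_sup_right : _ ≤ Γ) (Subgroup.mem_zpowers _)
      | some i => exact (le_sup_left : _ ≤ Γ) (hA _)) hfin
  exact ⟨Φ, hΦ none, fun i => hΦ (some i)⟩

/-- If `commFamily` is free and no `y ^ p ^ n` lies in the closed normal closure of the `x i`, then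
`y` and the `x i` have lifts to finite `p`-groups. -/
theorem exists_lift_of_isFreeProP_commFamily {p : ℕ} [Fact p.Prime] {r : ℕ} {F : Type u} [Group F]
    [TopologicalSpace F] [IsTopologicalGroup F] (hF : IsProP p F) {y : F} {x : Fin r → F}
    (hgen : (Subgroup.closure (insert y (Set.range x))).topologicalClosure = ⊤)
    (a : Fin r → ℕ → ℤ_[p]) (hfree : IsFreeProP p (commFamily hF y x a))
    (hy : ∀ n : ℕ, y ^ p ^ n ∉ closedNormalClosure x)
    (P : Type u) [Group P] [TopologicalSpace P] [DiscreteTopology P] [Finite P]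
    (hP : IsPGroup p P) (Y : P) (X : Fin r → P) :
    ∃ Φ : F →ₜ* P, Φ y = Y ∧ ∀ i, Φ (x i) = X i := by
  have hPp := IsProP.of_finite hP
  have hn := closedNormalClosure_normal x
  obtain ⟨n, hn1⟩ := commSeq_eventually_eq_one (p := p) hP
  obtain ⟨φ, hφ, -⟩ := hfree.existsUnique_lift P hPp
    (fun ij => commSeq p Y (X ij.1) (a ij.1) ij.2) (by
      rw [nhds_discrete, tendsto_pure]
      refine (Set.toFinite ((Set.univ : Set (Fin r)) ×ˢ Set.Iio n)).subset ?_
      rintro ⟨i, j⟩ hij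
      by_contra hj
      exact hij (hn1 _ _ _ j (by simpa using hj)))
  -- Both sides are continuous homomorphisms in `h`; on the generators they agree because the same
  -- recursion governs `y` in `F` and `Y` in `P`.
  have hequiv : ∀ h, φ (MulAut.conjNormal y h) = Y * φ h * Y⁻¹ := by
    have hc : Continuous (MulAut.conjNormal y : closedNormalClosure x ≃* closedNormalClosure x) :=
      Continuous.subtype_mk (by fun_prop) _
    have := eq_of_eqOn_topologicalGenerators (topologicalClosure_range_commFamily hF hgen a)
      (φ := φ.toMonoidHom.comp (MulAut.conjNormal y).toMonoidHom)
      (ψ := (MulAut.conj Y).toMonoidHom.comp φ.toMonoidHom)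
      (φ.continuous_toFun.comp hc)
      ((continuous_of_discreteTopology (f := MulAut.conj Y)).comp φ.continuous_toFun) (by
        rintro ⟨i, j⟩
        change φ (MulAut.conjNormal y _) = Y * φ _ * Y⁻¹
        have hpow := map_padicPow hfree.isProP hPp φ.toMonoidHom φ.continuous_toFun
          (commFamily hF y x a (i, j)) (p * a i j)
        change φ _ = padicPow p (φ _) _ at hpow
        rw [conjNormal_commFamily, map_mul, map_mul, map_inv, hpow, hφ, hφ]
        simp [commSeq, commutatorElement_def])
    exact DFunLike.congr_fun this
  obtain ⟨Φ, hΦy, hΦx⟩ := exists_lift_of_equivariant hF (closedNormalClosure_isClosed x)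
    (x := fun i => ⟨x i, mem_closedNormalClosure x i⟩) hgen hy hP φ Y hequiv
  exact ⟨Φ, hΦy, fun i => (hΦx i).trans (hφ (i, 0))⟩

theorem mainTheorem8 (p : ℕ) [Fact p.Prime] (r : ℕ) (hr : 1 ≤ r)
    {F : Type u} [Group F] [TopologicalSpace F] [IsTopologicalGroup F] (hF : IsProP p F)
    (y : F) (x : Fin r → F)
    (hgen : (Subgroup.closure (insert y (Set.range x))).topologicalClosure = ⊤)
    (a : Fin r → ℕ → ℤ_[p]) :
    -- (a)
    (Subgroup.closure
        (Set.range fun ij : Fin r × ℕ => commSeq p y (x ij.1) (a ij.1) ij.2)).topologicalClosure =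
      closedNormalClosure x ∧
    -- (b)
    (IsFreeProP p (Fin.cons y x : Fin (r + 1) → F) → IsFreeProP p (commFamily hF y x a)) ∧
    -- (c)
    (IsFreeProP p (commFamily hF y x a) →
      (∀ n : ℕ, y ^ p ^ n ∉ closedNormalClosure x) →
      IsFreeProP p (Fin.cons y x : Fin (r + 1) → F)) := by
  refine ⟨topologicalClosure_range_commSeq hF hgen a, fun hfree => ?_, fun hfree hy => ?_⟩
  · exact IsFreeProP.of_finite_lift (hF.subgroup _ (closedNormalClosure_isClosed x))
      (topologicalClosure_range_commFamily hF hgen a) (tendsto_commFamily hF a)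
      fun P _ _ _ _ hP f hf => exists_lift_commFamily hF hfree a P hP f hf
  · refine IsFreeProP.of_finite_lift hF (by rwa [Fin.range_cons]) (by simp [cofinite_eq_bot])
      fun P _ _ _ _ hP f _ => ?_
    obtain ⟨Φ, hΦy, hΦx⟩ := exists_lift_of_isFreeProP_commFamily hF hgen a hfree hy P hP (f 0)
      fun i => f i.succ
    exact ⟨Φ, Fin.cases hΦy hΦx⟩
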